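/- Let $N\ge 1$, $s\in(0,1)$ with $N>2s$, $\gamma\in(0,1)$, $\lambda>0$, and let $\Omega\subset\mathbb{R}^N$ be open and bounded. Let $f\in C(\Omega\times\mathbb{R},\mathbb{R})$ and put $F(x,t)=\int_0^t f(x,\tau)\,d\tau$. Assume: (A1) there is $\delta>0$ such that $f(x,-t)=-f(x,t)$ for all $x\in\Omega$ and $|t|\le\delta$; (A2) $\lim_{t\to0} f(x,t)/t=+\infty$ uniformly on $\Omega$; (A3) there are $r>0$ and $\alpha\in(1-\gamma,2)$ such that $t f(x,t)\le\alpha F(x,t)$ for all $x\in\Omega$ and $|t|\le r$. Fix $0<l\le\frac12\min\{\delta,r\}$ and a $C^1$ function $\xi:\mathbb{R}\to[0,1]$ with $\xi(t)=1$ for $|t|\le l$, $\xi$ decreasing (in the weak sense) on $[l,2l]$, and $\xi(t)=0$ for $|t|\ge 2l$. Put $\tilde f(x,t)=f(x,t)\xi(t)$ for $t\ge0$ and $\tilde f(x,t)=0$ for $t\le0$. Let $Q=\mathbb{R}^{2N}\setminus\big((\mathbb{R}^N\setminus\Omega)\times(\mathbb{R}^N\setminus\Omega)\big)$, and let $X_0$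 be the space of measurable $u:\mathbb{R}^N\to\mathbb{R}$ with $u|_\Omega\in L^2(\Omega)$, $\frac{|u(x)-u(y)|}{|x-y|^{(N+2s)/2}}\in L^2(Q)$ and $u=0$ a.e. in $\mathbb{R}^N\setminus\Omega$. A function $u\in X_0$ is a weak solution of $$(-\Delta)^s u=\lambda\frac{\operatorname{sign}(u)}{|u|^{\gamma}}+\tilde f(x,u)\ \text{ in }\Omega,\qquad u=0\ \text{ in }\mathbb{R}^N\setminus\Omega,$$ if for every $\phi\in X_0$ one has $\phi|u|^{-\gamma}\in L^1(\Omega)$, $\tilde f(\cdot,u)\phi\in L^1(\Omega)$ and $$\int_Q\frac{(u(x)-u(y))(\phi(x)-\phi(y))}{|x-y|^{N+2s}}\,dx\,dy-\int_\Omega\Big(\frac{\lambda\operatorname{sign}(u)}{|u|^\gamma}+\tilde f(x,u)\Big)\phi\,dx=0 .$$ Then every weak solution $u\in X_0$ of this problem with $u>0$ a.e. in $\Omega$ belongs to $L^\infty(\Omega)$. -/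

import Mathlib

open MeasureTheory Set

noncomputable section

namespace FracSingular

/-- The set `Q = ℝ²ᴺ \ ((ℝᴺ \ Ω) × (ℝᴺ \ Ω))`. -/
def Q {N : ℕ} (Ω : Set (EuclideanSpace ℝ (Fin N))) :
    Set (EuclideanSpace ℝ (Fin N) × EuclideanSpace ℝ (Fin N)) :=
  (Ωᶜ ×ˢ Ωᶜ)ᶜ

/-- The space `X` of the (Lebesgue) measurable `u : ℝᴺ → ℝ` with `u|_Ω ∈ L²(Ω)` and
`|u(x) - u(y)| / |x - y|^((N + 2s)/2) ∈ L²(Q)`. -/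
def X {N : ℕ} (s : ℝ) (Ω : Set (EuclideanSpace ℝ (Fin N))) :
    Set (EuclideanSpace ℝ (Fin N) → ℝ) :=
  {u | AEMeasurable u volume ∧
    MemLp u 2 (volume.restrict Ω) ∧
    MemLp (fun p : EuclideanSpace ℝ (Fin N) × EuclideanSpace ℝ (Fin N) =>
      |u p.1 - u p.2| / ‖p.1 - p.2‖ ^ (((N : ℝ) + 2 * s) / 2)) 2 (volume.restrict (Q Ω))}

/-- The subspace `X₀` of the functions in `X` that vanish a.e. outside `Ω`. -/
def X₀ {N : ℕ} (s : ℝ) (Ω : Set (EuclideanSpace ℝ (Fin N))) :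
    Set (EuclideanSpace ℝ (Fin N) → ℝ) :=
  {u | u ∈ X s Ω ∧ ∀ᵐ x ∂(volume.restrict Ωᶜ), u x = 0}

/-- `∫_Q (u(x) - u(y)) (φ(x) - φ(y)) / |x - y|^(N + 2s) dx dy`. -/
def gagliardoForm {N : ℕ} (s : ℝ) (Ω : Set (EuclideanSpace ℝ (Fin N)))
    (u φ : EuclideanSpace ℝ (Fin N) → ℝ) : ℝ :=
  ∫ p in Q Ω, (u p.1 - u p.2) * (φ p.1 - φ p.2) / ‖p.1 - p.2‖ ^ ((N : ℝ) + 2 * s)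

/-- The admissible cutoff functions `ξ` at level `l`. -/
structure IsCutoff (l : ℝ) (ξ : ℝ → ℝ) : Prop where
  contDiff : ContDiff ℝ 1 ξ
  nonneg : ∀ t, 0 ≤ ξ t
  le_one : ∀ t, ξ t ≤ 1
  eq_one : ∀ t, |t| ≤ l → ξ t = 1
  antitoneOn : AntitoneOn ξ (Icc l (2 * l))
  eq_zero : ∀ t, 2 * l ≤ |t| → ξ t = 0

/-- The truncated nonlinearity: `f(x,t) ξ(t)` for `t ≥ 0`, and `0` for `t ≤ 0`
(under the oddness of `f(x,·)` near `0` the two cases agree at `t = 0`). -/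
def cutoffNonlinearity {N : ℕ} (f : EuclideanSpace ℝ (Fin N) → ℝ → ℝ) (ξ : ℝ → ℝ)
    (x : EuclideanSpace ℝ (Fin N)) (t : ℝ) : ℝ :=
  if 0 ≤ t then f x t * ξ t else 0

/-- `u` is a weak solution of `(-Δ)^s u = lam * sign(u) |u|^(-γ) + g(x,u)` in `Ω`,
`u = 0` in `ℝᴺ \ Ω`. -/
structure IsWeakSolution {N : ℕ} (s γ lam : ℝ) (Ω : Set (EuclideanSpace ℝ (Fin N)))
    (g : EuclideanSpace ℝ (Fin N) → ℝ → ℝ) (u : EuclideanSpace ℝ (Fin N) → ℝ) : Prop where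
  mem : u ∈ X₀ s Ω
  /-- `φ |u|^(-γ) ∈ L¹(Ω)`; computed in `[0,∞]`, so that `|u|^(-γ) = ∞` where `u = 0`. -/
  singular_integrable : ∀ φ ∈ X₀ s Ω, ∫⁻ x in Ω, ‖φ x‖ₑ * ‖u x‖ₑ ^ (-γ) < ⊤
  /-- The remaining part of the right-hand side has a well-defined integral. -/
  source_integrable : ∀ φ ∈ X₀ s Ω, IntegrableOn (fun x => g x (u x) * φ x) Ω
  weak_eq : ∀ φ ∈ X₀ s Ω,
    gagliardoForm s Ω u φ -
      ∫ x in Ω, (lam * Real.sign (u x) / |u x| ^ γ + g x (u x)) * φ x = 0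

end FracSingular

end

/-!
The truncated nonlinearity `f(x,t) ξ(t)` vanishes for `t ≥ 2 l`. Where the solution `u` exceeds `2 l`,
the equation is therefore `(-Δ)^s u = lam u ^ (-γ) ≤ lam (2 l) ^ (-γ)`, with a bounded right-hand side,
even where `f` itself is unbounded near `∂Ω`. The upper bound then follows by Stampacchia's
truncation method.

Testing with `φ = (u - k)⁺`, `k ≥ 2 l`, gives `gagliardoForm φ φ ≤ C ∫ φ`
(`gagliardoForm_truncation_le`). In place of the fractional Sobolev inequality, the gain comes from
the more elementary Faber–Krahn inequality `c |A| ^ (-2 s / N) ∫ φ² ≤ gagliardoForm φ φ` for `φ`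
supported in `A` (`exists_faberKrahn_const`), which follows by restricting the double integral to
`A × Aᶜ` and estimating the mass of the kernel outside `A` (`exists_tail_lower_bound`). With
`A = {u > k}`, Young's inequality and Chebyshev's inequality, this yields
`|{u > h}| ≤ D |{u > k}| ^ (1 + 4 s / N) / (h - k) ^ 2` for `h > k ≥ 2 l`, and
`exists_eq_zero_of_le_rpow_div_sq` turns such a superlinear decay into `|{u > h}| = 0` for some `h`.
-/

open MeasureTheory Set

noncomputable section

namespace FracSingular

/-! ### An iteration lemma -/

/-- **Stampacchia's iteration lemma**: the superlinear exponent `1 + β` forces `m` to decay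
geometrically along the levels `K + d (1 - 2⁻ⁿ)` once `d` is large, so `m` vanishes at `K + d`. -/
theorem exists_eq_zero_of_le_rpow_div_sq {m : ℝ → ℝ} {D β K : ℝ} (hβ : 0 < β) (hD : 0 ≤ D)
    (hm0 : ∀ k, 0 ≤ m k) (hm : Antitone m)
    (hdec : ∀ k h, K ≤ k → k < h → m h ≤ D * m k ^ (1 + β) / (h - k) ^ 2) :
    ∃ h, m h = 0 := by
  set q : ℝ := (1 / 4 : ℝ) ^ (1 / β) with hq
  have hq0 : 0 < q := by positivity
  have hqβ : q ^ β = 1 / 4 := by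
    rw [hq, ← Real.rpow_mul (by norm_num)]
    field_simp
    simp
  have hq1 : q < 1 := Real.rpow_lt_one (by norm_num) (by norm_num) (by positivity)
  -- `d` is chosen so that one step of the iteration gains exactly the factor `q`.
  set E : ℝ := 4 * D * m K ^ β / q with hE
  have hE0 : 0 ≤ E := by have := hm0 K; positivity
  obtain ⟨d, hd0, hd⟩ : ∃ d : ℝ, 0 < d ∧ E ≤ d ^ 2 := ⟨E + 1, by positivity, by nlinarith⟩
  have hdq : 4 * D * m K ^ β ≤ q * d ^ 2 := by
    rw [hE, div_le_iff₀ hq0] at hd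
    linarith
  set t : ℕ → ℝ := fun n => K + d * (1 - (1 / 2) ^ n) with ht
  have hstep : ∀ n, m (t n) ≤ m K * q ^ n := by
    intro n
    induction n with
    | zero => simp [ht]
    | succ n ih =>
      have hK : K ≤ t n := by
        have : (1 / 2 : ℝ) ^ n ≤ 1 := pow_le_one₀ (by norm_num) (by norm_num)
        simp only [ht]
        nlinarith
      have hdiff : t (n + 1) - t n = d * (1 / 2) ^ (n + 1) := by
        simp only [ht]; ring
      have hlt : t n < t (n + 1) := by
        have : 0 < d * (1 / 2 : ℝ) ^ (n + 1) := by positivity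
        linarith
      refine (hdec _ _ hK hlt).trans ?_
      rw [hdiff, div_le_iff₀ (by positivity)]
      have h1 : m (t n) ^ (1 + β) ≤ (m K * q ^ n) ^ (1 + β) :=
        Real.rpow_le_rpow (hm0 _) ih (by positivity)
      have h2 : (m K * q ^ n) ^ (1 + β) = m K * m K ^ β * (q ^ n * (1 / 4) ^ n) := by
        rw [Real.mul_rpow (hm0 K) (by positivity),
          Real.rpow_add_of_nonneg (hm0 K) zero_le_one hβ.le,
          Real.rpow_add (by positivity), Real.rpow_one, Real.rpow_one,
          ← Real.rpow_pow_comm hq0.le, hqβ]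
      calc D * m (t n) ^ (1 + β) ≤ D * (m K * m K ^ β * (q ^ n * (1 / 4) ^ n)) := by
            rw [← h2]; gcongr
        _ = (4 * D * m K ^ β) * (m K * q ^ n * ((1 / 2) ^ (n + 1)) ^ 2) := by
            rw [← pow_mul, mul_comm (n + 1) 2, pow_mul, pow_succ]; ring
        _ ≤ (q * d ^ 2) * (m K * q ^ n * ((1 / 2) ^ (n + 1)) ^ 2) := by
            have := hm0 K
            gcongr
        _ = m K * q ^ (n + 1) * (d * (1 / 2) ^ (n + 1)) ^ 2 := by ring
  refine ⟨K + d, le_antisymm ?_ (hm0 _)⟩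
  have hlim : Filter.Tendsto (fun n : ℕ => m K * q ^ n) Filter.atTop (nhds 0) := by
    simpa using (tendsto_pow_atTop_nhds_zero_of_lt_one hq0.le hq1).const_mul (m K)
  refine ge_of_tendsto' hlim fun n => (hm ?_).trans (hstep n)
  have : 0 < d * (1 / 2 : ℝ) ^ n := by positivity
  simp only [ht]
  linarith

/-! ### The kernel outside a set of given measure -/

/-- The ball around `x` of measure `2 |A|` has at least `|A|` of its mass outside `A`, and its radius
is a multiple of `|A| ^ (1 / N)`; hence the kernel `‖x - y‖⁻ᵖ` has mass at least a multiple of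
`|A| ^ (1 - p / N)` outside `A`. -/
theorem exists_tail_lower_bound {N : ℕ} (hN : 0 < N) {p : ℝ} (hp : 0 < p) :
    ∃ c : ℝ, 0 < c ∧ ∀ A : Set (EuclideanSpace ℝ (Fin N)), 0 < volume.real A →
      ∀ x ∈ A, ENNReal.ofReal (c * volume.real A ^ (1 - p / N)) ≤
        ∫⁻ y in Aᶜ, ENNReal.ofReal (1 / ‖x - y‖ ^ p) := by
  have hN' : (0 : ℝ) < N := by exact_mod_cast hN
  set ω : ℝ := volume.real (Metric.ball (0 : EuclideanSpace ℝ (Fin N)) 1) with hω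
  have hω0 : 0 < ω := ENNReal.toReal_pos
    (Metric.measure_ball_pos _ _ one_pos).ne' measure_ball_lt_top.ne
  refine ⟨(2 / ω) ^ (-(p / N)), by positivity, fun A hA x hx => ?_⟩
  set m : ℝ := volume.real A with hm
  -- the radius for which the ball around `x` has measure `2 * m`
  set R : ℝ := (2 * m / ω) ^ (1 / (N : ℝ)) with hR
  have hR0 : 0 < R := by positivity
  have hball : volume.real (Metric.closedBall x R) = 2 * m := by
    rw [Measure.addHaar_real_closedBall _ _ hR0.le, finrank_euclideanSpace_fin, hR,
      ← Real.rpow_natCast, ← Real.rpow_mul (by positivity), one_div_mul_cancel hN'.ne',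
      Real.rpow_one, ← hω]
    field_simp
  have hAfin : volume A ≠ ⊤ := fun h => by simp [hm, measureReal_def, h] at hA
  have hdiff : m ≤ volume.real (Metric.closedBall x R \ A) := by
    have := le_measureReal_sdiff (μ := volume) (s₁ := Metric.closedBall x R) (s₂ := A) hAfin
    linarith
  have hconst : (2 / ω) ^ (-(p / N)) * m ^ (1 - p / N) = 1 / R ^ p * m := by
    have h1 : R ^ p = (2 / ω) ^ (p / N) * m ^ (p / N) := by
      rw [hR, ← Real.rpow_mul (by positivity), ← Real.mul_rpow (by positivity) hA.le]
      congr 1 <;> ring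
    rw [h1, Real.rpow_sub hA, Real.rpow_neg (by positivity), Real.rpow_one]
    field_simp
  calc ENNReal.ofReal ((2 / ω) ^ (-(p / N)) * m ^ (1 - p / N))
      = ENNReal.ofReal (1 / R ^ p) * ENNReal.ofReal m := by
        rw [hconst, ENNReal.ofReal_mul (by positivity)]
    _ ≤ ENNReal.ofReal (1 / R ^ p) * volume (Metric.closedBall x R \ A) := by
        gcongr
        refine (ENNReal.ofReal_le_ofReal hdiff).trans ?_
        rw [measureReal_def, ENNReal.ofReal_toReal]
        exact ((measure_mono sdiff_subset).trans_lt measure_closedBall_lt_top).ne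
    _ = ∫⁻ _ in Metric.closedBall x R \ A, ENNReal.ofReal (1 / R ^ p) :=
        (setLIntegral_const _ _).symm
    _ ≤ ∫⁻ y in Metric.closedBall x R \ A, ENNReal.ofReal (1 / ‖x - y‖ ^ p) := by
        refine setLIntegral_mono (by fun_prop) fun y hy => ENNReal.ofReal_le_ofReal ?_
        have hxy : 0 < ‖x - y‖ := norm_pos_iff.2 (sub_ne_zero.2 fun h => hy.2 (h ▸ hx))
        have hle : ‖x - y‖ ≤ R := by
          rw [← dist_eq_norm, dist_comm]; exact hy.1
        gcongr
    _ ≤ ∫⁻ y in Aᶜ, ENNReal.ofReal (1 / ‖x - y‖ ^ p) :=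
        lintegral_mono_set fun y hy => hy.2

/-! ### The space `X₀` and the Gagliardo form -/

variable {N : ℕ} {s : ℝ} {Ω : Set (EuclideanSpace ℝ (Fin N))}

theorem ae_restrict_Q_eq {u v : EuclideanSpace ℝ (Fin N) → ℝ} (h : u =ᵐ[volume] v) :
    ∀ᵐ p ∂(volume.restrict (Q Ω)), u p.1 = v p.1 ∧ u p.2 = v p.2 :=
  ae_restrict_of_ae ((Measure.quasiMeasurePreserving_fst.ae_eq h).and
    (Measure.quasiMeasurePreserving_snd.ae_eq h))

theorem mem_X₀_congr {u v : EuclideanSpace ℝ (Fin N) → ℝ} (h : u =ᵐ[volume] v)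
    (hu : u ∈ X₀ s Ω) : v ∈ X₀ s Ω := by
  obtain ⟨⟨h1, h2, h3⟩, h4⟩ := hu
  refine ⟨⟨h1.congr h, h2.ae_eq (ae_restrict_of_ae h), h3.ae_eq ?_⟩, ?_⟩
  · filter_upwards [ae_restrict_Q_eq h] with p hp
    rw [hp.1, hp.2]
  · filter_upwards [h4, ae_restrict_of_ae h] with x h4 h
    rw [← h, h4]

theorem gagliardoForm_congr {u v φ ψ : EuclideanSpace ℝ (Fin N) → ℝ} (h : u =ᵐ[volume] v)
    (h' : φ =ᵐ[volume] ψ) : gagliardoForm s Ω u φ = gagliardoForm s Ω v ψ := by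
  refine integral_congr_ae ?_
  filter_upwards [ae_restrict_Q_eq h, ae_restrict_Q_eq h'] with p hp hp'
  rw [hp.1, hp.2, hp'.1, hp'.2]

theorem max_sub_mem_X₀ {v : EuclideanSpace ℝ (Fin N) → ℝ} (hv : v ∈ X₀ s Ω) {k : ℝ}
    (hk : 0 ≤ k) : (fun x => max (v x - k) 0) ∈ X₀ s Ω := by
  obtain ⟨⟨h1, h2, h3⟩, h4⟩ := hv
  have hm : AEMeasurable (fun x => max (v x - k) 0) volume := by fun_prop
  refine ⟨⟨hm, h2.of_le hm.restrict.aestronglyMeasurable (ae_of_all _ fun x => ?_),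
    h3.of_le ?_ (ae_of_all _ fun p => ?_)⟩, ?_⟩
  · rw [Real.norm_eq_abs, Real.norm_eq_abs, abs_of_nonneg (le_max_right _ _)]
    exact max_le (by linarith [le_abs_self (v x)]) (abs_nonneg _)
  · refine AEMeasurable.aestronglyMeasurable (AEMeasurable.restrict ?_)
    have e1 : AEMeasurable (fun p : EuclideanSpace ℝ (Fin N) × EuclideanSpace ℝ (Fin N) =>
        max (v p.1 - k) 0) volume := hm.comp_quasiMeasurePreserving Measure.quasiMeasurePreserving_fst
    have e2 : AEMeasurable (fun p : EuclideanSpace ℝ (Fin N) × EuclideanSpace ℝ (Fin N) =>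
        max (v p.2 - k) 0) volume := hm.comp_quasiMeasurePreserving Measure.quasiMeasurePreserving_snd
    exact (e1.sub e2).abs.div (by fun_prop)
  · have := abs_max_sub_max_le_abs (v p.1 - k) (v p.2 - k) 0
    rw [sub_sub_sub_cancel_right] at this
    rw [norm_div, norm_div, norm_abs_eq_norm, norm_abs_eq_norm]
    exact div_le_div_of_nonneg_right this (norm_nonneg _)
  · filter_upwards [h4] with x hx
    simp [hx, hk]

/-- The integrand is the product of two functions in `L²(Q)`, up to signs. On the diagonal, where the
kernel is `1 / 0 = 0`, both sides vanish. -/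
theorem integrableOn_gagliardo (hs : 0 < s) {u φ : EuclideanSpace ℝ (Fin N) → ℝ}
    (hu : u ∈ X₀ s Ω) (hφ : φ ∈ X₀ s Ω) :
    IntegrableOn (fun p : EuclideanSpace ℝ (Fin N) × EuclideanSpace ℝ (Fin N) =>
      (u p.1 - u p.2) * (φ p.1 - φ p.2) / ‖p.1 - p.2‖ ^ ((N : ℝ) + 2 * s)) (Q Ω) := by
  have hi := hu.1.2.2.integrable_mul hφ.1.2.2
  have hm : ∀ w ∈ X₀ s Ω, AEMeasurable
      (fun p : EuclideanSpace ℝ (Fin N) × EuclideanSpace ℝ (Fin N) => w p.1 - w p.2) volume :=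
    fun w hw => (hw.1.1.comp_quasiMeasurePreserving Measure.quasiMeasurePreserving_fst).sub
      (hw.1.1.comp_quasiMeasurePreserving Measure.quasiMeasurePreserving_snd)
  refine hi.mono (AEMeasurable.aestronglyMeasurable (AEMeasurable.restrict
    (((hm u hu).mul (hm φ hφ)).div (by fun_prop)))) (ae_of_all _ fun p => le_of_eq ?_)
  have hN : (0 : ℝ) ≤ N := Nat.cast_nonneg N
  have hsplit : ‖p.1 - p.2‖ ^ ((N : ℝ) + 2 * s) =
      ‖p.1 - p.2‖ ^ (((N : ℝ) + 2 * s) / 2) * ‖p.1 - p.2‖ ^ (((N : ℝ) + 2 * s) / 2) := by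
    rw [← Real.rpow_add_of_nonneg (norm_nonneg _) (by positivity) (by positivity), add_halves]
  rw [hsplit, mul_div_mul_comm]
  simp

/-! ### Faber–Krahn inequality -/

/-- **Fractional Faber–Krahn inequality.** It suffices to keep the part `A ×ˢ Aᶜ` of `Q Ω` in the
energy, where the integrand is `φ x ^ 2 / ‖x - y‖ ^ (N + 2 * s)` because `φ` vanishes on `Aᶜ`. -/
theorem exists_faberKrahn_const (hN : 0 < N) (hs : 0 < s) :
    ∃ c : ℝ, 0 < c ∧ ∀ A Ω : Set (EuclideanSpace ℝ (Fin N)), MeasurableSet A → A ⊆ Ω →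
      0 < volume.real A → ∀ φ ∈ X₀ s Ω, (∀ x ∉ A, φ x = 0) →
        c * volume.real A ^ (-(2 * s / N)) * ∫ x in A, φ x ^ 2 ≤ gagliardoForm s Ω φ φ := by
  have hN' : (0 : ℝ) < N := by exact_mod_cast hN
  obtain ⟨c, hc, htail⟩ := exists_tail_lower_bound hN (p := (N : ℝ) + 2 * s) (by positivity)
  refine ⟨c, hc, fun A Ω hA hAΩ hm φ hφ hφA => ?_⟩
  have hexp : 1 - ((N : ℝ) + 2 * s) / N = -(2 * s / N) := by field_simp; ring
  rw [hexp] at htail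
  set K : ℝ := c * volume.real A ^ (-(2 * s / N)) with hK
  have hK0 : 0 ≤ K := by positivity
  have hsub : A ×ˢ Aᶜ ⊆ Q Ω := fun p hp hq => hq.1 (hAΩ hp.1)
  have hsq : IntegrableOn (fun x => φ x ^ 2) A :=
    (hφ.1.2.1.mono_measure (Measure.restrict_mono_set _ hAΩ)).integrable_sq
  have hint := integrableOn_gagliardo hs hφ hφ
  have hnn : ∀ p : EuclideanSpace ℝ (Fin N) × EuclideanSpace ℝ (Fin N),
      0 ≤ (φ p.1 - φ p.2) * (φ p.1 - φ p.2) / ‖p.1 - p.2‖ ^ ((N : ℝ) + 2 * s) :=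
    fun p => div_nonneg (mul_self_nonneg _) (by positivity)
  have hpow : 0 ≤ gagliardoForm s Ω φ φ := integral_nonneg hnn
  refine (ENNReal.ofReal_le_ofReal_iff hpow).1 ?_
  have hmeas := (hint.mono_set hsub).aestronglyMeasurable.aemeasurable.ennreal_ofReal
  rw [Measure.volume_eq_prod, ← Measure.prod_restrict] at hmeas
  calc ENNReal.ofReal (K * ∫ x in A, φ x ^ 2)
      = ENNReal.ofReal K * ∫⁻ x in A, ENNReal.ofReal (φ x ^ 2) := by
        rw [ENNReal.ofReal_mul hK0,
          ofReal_integral_eq_lintegral_ofReal hsq (ae_of_all _ fun x => sq_nonneg _)]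
    _ = ∫⁻ x in A, ENNReal.ofReal K * ENNReal.ofReal (φ x ^ 2) :=
        (lintegral_const_mul' _ _ ENNReal.ofReal_ne_top).symm
    _ ≤ ∫⁻ x in A, ∫⁻ y in Aᶜ, ENNReal.ofReal
          ((φ x - φ y) * (φ x - φ y) / ‖x - y‖ ^ ((N : ℝ) + 2 * s)) := by
        refine setLIntegral_mono' hA fun x hx => ?_
        calc ENNReal.ofReal K * ENNReal.ofReal (φ x ^ 2)
            ≤ (∫⁻ y in Aᶜ, ENNReal.ofReal (1 / ‖x - y‖ ^ ((N : ℝ) + 2 * s))) *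
                ENNReal.ofReal (φ x ^ 2) := by
              gcongr
              exact htail A hm x hx
          _ = ∫⁻ y in Aᶜ, ENNReal.ofReal (1 / ‖x - y‖ ^ ((N : ℝ) + 2 * s)) *
                ENNReal.ofReal (φ x ^ 2) := (lintegral_mul_const' _ _ ENNReal.ofReal_ne_top).symm
          _ = _ := by
              refine setLIntegral_congr_fun hA.compl fun y hy => ?_
              rw [hφA y hy, ← ENNReal.ofReal_mul (by positivity)]
              congr 1
              ring
    _ = ∫⁻ p in A ×ˢ Aᶜ, ENNReal.ofReal
          ((φ p.1 - φ p.2) * (φ p.1 - φ p.2) / ‖p.1 - p.2‖ ^ ((N : ℝ) + 2 * s)) := by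
        rw [Measure.volume_eq_prod, ← Measure.prod_restrict, lintegral_prod _ hmeas]
    _ ≤ ∫⁻ p in Q Ω, ENNReal.ofReal
          ((φ p.1 - φ p.2) * (φ p.1 - φ p.2) / ‖p.1 - p.2‖ ^ ((N : ℝ) + 2 * s)) :=
        lintegral_mono_set hsub
    _ = ENNReal.ofReal (gagliardoForm s Ω φ φ) :=
        (ofReal_integral_eq_lintegral_ofReal hint (ae_of_all _ hnn)).symm

/-! ### Boundedness of subsolutions above a level -/

/-- Pointwise, `(a - b) (a⁺ - b⁺) ≥ (a⁺ - b⁺)²` for `a = v x - k` and `b = v y - k`. -/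
theorem gagliardoForm_truncation_le (hs : 0 < s) {v : EuclideanSpace ℝ (Fin N) → ℝ}
    (hv : v ∈ X₀ s Ω) {k : ℝ} (hk : 0 ≤ k) :
    gagliardoForm s Ω (fun x => max (v x - k) 0) (fun x => max (v x - k) 0) ≤
      gagliardoForm s Ω v (fun x => max (v x - k) 0) := by
  have hφ := max_sub_mem_X₀ hv hk
  refine integral_mono (integrableOn_gagliardo hs hφ hφ) (integrableOn_gagliardo hs hv hφ)
    fun p => div_le_div_of_nonneg_right ?_ (by positivity)
  rcases le_total (v p.1 - k) 0 with h1 | h1 <;> rcases le_total (v p.2 - k) 0 with h2 | h2 <;>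
    simp only [max_eq_left, max_eq_right, h1, h2] <;> nlinarith

/-- **Stampacchia's boundedness theorem** for the fractional Laplacian: `v` is bounded above if it
satisfies `(-Δ)^s v ≤ C` weakly above the level `K`, that is, when tested with the truncations
`(v - k)⁺`, `k ≥ K`. -/
theorem exists_ae_le_of_gagliardoForm_truncation_le (hN : 0 < N) (hs : 0 < s)
    (hΩ : MeasurableSet Ω) (hΩfin : volume Ω ≠ ⊤) {v : EuclideanSpace ℝ (Fin N) → ℝ}
    (hvm : Measurable v) (hv : v ∈ X₀ s Ω) (hv0 : ∀ x ∉ Ω, v x = 0) {K C : ℝ} (hK : 0 ≤ K)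
    (hsub : ∀ k, K ≤ k → gagliardoForm s Ω v (fun x => max (v x - k) 0) ≤
      C * ∫ x in Ω, max (v x - k) 0) :
    ∃ h, ∀ᵐ x ∂(volume.restrict Ω), v x ≤ h := by
  have hN' : (0 : ℝ) < N := by exact_mod_cast hN
  obtain ⟨c, hc, hFK⟩ := exists_faberKrahn_const hN hs
  set A : ℝ → Set (EuclideanSpace ℝ (Fin N)) := fun k => Ω ∩ {x | k < v x} with hA
  have hAm : ∀ k, MeasurableSet (A k) := fun k => hΩ.inter (measurableSet_lt measurable_const hvm)
  have hAΩ : ∀ k, A k ⊆ Ω := fun k => inter_subset_left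
  have hAfin : ∀ k, volume (A k) ≠ ⊤ := fun k =>
    ((measure_mono (hAΩ k)).trans_lt hΩfin.lt_top).ne
  have hAanti : ∀ k h, k ≤ h → A h ⊆ A k := fun k h hkh x hx => ⟨hx.1, hkh.trans_lt hx.2⟩
  obtain ⟨h, hh⟩ := exists_eq_zero_of_le_rpow_div_sq (m := fun k => volume.real (A k))
    (D := C ^ 2 / c ^ 2) (β := 4 * s / N) (K := K) (by positivity) (by positivity)
    (fun k => measureReal_nonneg) (fun k h hkh => measureReal_mono (hAanti k h hkh) (hAfin k)) <| by
      intro k h hk hkh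
      have hk0 : 0 ≤ k := hK.trans hk
      rw [le_div_iff₀ (by nlinarith)]
      -- The exponent of `|A k|` in the Faber–Krahn constant is negative, so `|A k| = 0` is set apart.
      rcases (measureReal_nonneg (μ := volume) (s := A k)).eq_or_lt with hm | hm
      · have h0 : volume.real (A h) = 0 := le_antisymm
          ((measureReal_mono (hAanti k h hkh.le) (hAfin k)).trans hm.ge) measureReal_nonneg
        rw [h0, zero_mul]
        positivity
      set m := volume.real (A k)
      set φ : EuclideanSpace ℝ (Fin N) → ℝ := fun x => max (v x - k) 0 with hφdef
      have hφ : φ ∈ X₀ s Ω := max_sub_mem_X₀ hv hk0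
      have hφA : ∀ x ∉ A k, φ x = 0 := by
        intro x hx
        refine max_eq_right ?_
        by_cases hxΩ : x ∈ Ω
        · exact sub_nonpos.2 (not_lt.1 fun hlt => hx ⟨hxΩ, hlt⟩)
        · rw [hv0 x hxΩ]; linarith
      have hφ2 : MemLp φ 2 (volume.restrict (A k)) :=
        hφ.1.2.1.mono_measure (Measure.restrict_mono_set _ (hAΩ k))
      have : IsFiniteMeasure (volume.restrict (A k)) := ⟨by simpa using (hAfin k).lt_top⟩
      have hφ1 : Integrable φ (volume.restrict (A k)) := hφ2.integrable (by norm_num)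
      have hsq := hφ2.integrable_sq
      have hΩA : ∫ x in Ω, φ x = ∫ x in A k, φ x :=
        setIntegral_eq_of_subset_of_forall_sdiff_eq_zero hΩ (hAΩ k) fun x hx => hφA x hx.2
      set κ : ℝ := c * m ^ (-(2 * s / N)) with hκ
      have hκ0 : 0 < κ := by positivity
      have henergy : κ * ∫ x in A k, φ x ^ 2 ≤ C * ∫ x in A k, φ x :=
        (hFK _ Ω (hAm k) (hAΩ k) hm φ hφ hφA).trans
          ((gagliardoForm_truncation_le hs hv hk0).trans (hΩA ▸ hsub k hk))
      -- Young's inequality `C φ ≤ κ φ² / 2 + C² / (2 κ)`; the first term is absorbed by `henergy`.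
      have hyoung : C * ∫ x in A k, φ x ≤ κ / 2 * (∫ x in A k, φ x ^ 2) + C ^ 2 / (2 * κ) * m := by
        have hconst : ∫ _ in A k, C ^ 2 / (2 * κ) = C ^ 2 / (2 * κ) * m := by
          rw [setIntegral_const, smul_eq_mul, mul_comm]
        rw [← hconst, ← integral_const_mul, ← integral_const_mul,
          ← integral_add (hsq.const_mul _) (integrable_const _)]
        refine integral_mono (hφ1.const_mul _) ((hsq.const_mul _).add (integrable_const _))
          fun x => ?_
        have : κ / 2 * φ x ^ 2 + C ^ 2 / (2 * κ) - C * φ x = (κ * φ x - C) ^ 2 / (2 * κ) := by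
          field_simp; ring
        have : 0 ≤ (κ * φ x - C) ^ 2 / (2 * κ) := by positivity
        simp only
        linarith
      have hL2 : ∫ x in A k, φ x ^ 2 ≤ C ^ 2 / κ ^ 2 * m := by
        have h1 : κ / 2 * ∫ x in A k, φ x ^ 2 ≤ κ / 2 * (C ^ 2 / κ ^ 2 * m) := by
          have : κ / 2 * (C ^ 2 / κ ^ 2 * m) = C ^ 2 / (2 * κ) * m := by field_simp
          linarith
        exact le_of_mul_le_mul_left h1 (by positivity)
      have hpow : C ^ 2 / κ ^ 2 * m = C ^ 2 / c ^ 2 * m ^ (1 + 4 * s / N) := by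
        have : (m ^ (-(2 * s / N)) : ℝ) ^ 2 * m ^ (4 * s / N) = 1 := by
          rw [← Real.rpow_natCast, ← Real.rpow_mul hm.le, ← Real.rpow_add hm]
          have : -(2 * s / N) * ((2 : ℕ) : ℝ) + 4 * s / N = 0 := by push_cast; ring
          rw [this, Real.rpow_zero]
        have hne : (m ^ (-(2 * s / N)) : ℝ) ≠ 0 := by positivity
        rw [Real.rpow_add hm, Real.rpow_one, hκ, eq_div_of_mul_eq (pow_ne_zero 2 hne)
          ((mul_comm _ _).trans this)]
        field_simp
      -- Chebyshev: `φ ≥ h - k` on the smaller superlevel set `A h`.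
      have hcheb : volume.real (A h) * (h - k) ^ 2 ≤ ∫ x in A k, φ x ^ 2 := by
        calc volume.real (A h) * (h - k) ^ 2 = ∫ _ in A h, (h - k) ^ 2 := by
              rw [setIntegral_const, smul_eq_mul]
          _ ≤ ∫ x in A h, φ x ^ 2 := by
              refine setIntegral_mono_on (integrableOn_const (hAfin h))
                (IntegrableOn.mono_set hsq (hAanti k h hkh.le)) (hAm h) fun x hx => ?_
              have h1 : h - k ≤ φ x := (sub_le_sub_right hx.2.le k).trans (le_max_left _ _)
              have h2 : 0 ≤ h - k := by linarith
              gcongr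
          _ ≤ ∫ x in A k, φ x ^ 2 :=
              setIntegral_mono_set hsq (ae_of_all _ fun x => sq_nonneg _)
                (hAanti k h hkh.le).eventuallyLE
      exact hcheb.trans (hL2.trans hpow.le)
  refine ⟨h, ?_⟩
  rw [ae_restrict_iff' hΩ, ae_iff]
  have h0 : volume (A h) = 0 := (measureReal_eq_zero_iff (hAfin h)).1 hh
  refine measure_mono_null (fun x hx => ?_) h0
  obtain ⟨h1, h2⟩ := Classical.not_imp.1 hx
  exact ⟨h1, not_le.1 h2⟩

/-- The source `g` only needs to vanish for large values of the solution: where `u ≥ K`, the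
right-hand side reduces to the singular term, which is at most `lam / K ^ γ` there. -/
theorem memLp_top_of_isWeakSolution {γ lam : ℝ} {g : EuclideanSpace ℝ (Fin N) → ℝ → ℝ} {K : ℝ}
    (hN : 0 < N) (hs : 0 < s) (hγ : 0 ≤ γ) (hlam : 0 ≤ lam) (hΩ : MeasurableSet Ω)
    (hΩfin : volume Ω ≠ ⊤) (hK : 0 < K) (hg : ∀ x ∈ Ω, ∀ t, K ≤ t → g x t = 0)
    {u : EuclideanSpace ℝ (Fin N) → ℝ} (hu : IsWeakSolution s γ lam Ω g u)
    (hpos : ∀ᵐ x ∂(volume.restrict Ω), 0 ≤ u x) :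
    MemLp u ⊤ (volume.restrict Ω) := by
  -- A Borel representative of `u` that vanishes everywhere, not only a.e., outside `Ω`.
  obtain ⟨v, hvm, hv0, huv⟩ : ∃ v : EuclideanSpace ℝ (Fin N) → ℝ, Measurable v ∧
      (∀ x ∉ Ω, v x = 0) ∧ u =ᵐ[volume] v := by
    have hm := hu.mem.1.1
    refine ⟨Ω.indicator (hm.mk u), hm.measurable_mk.indicator hΩ,
      fun x hx => indicator_of_notMem hx _, ?_⟩
    filter_upwards [hm.ae_eq_mk, (ae_restrict_iff' hΩ.compl).1 hu.mem.2] with x h1 h2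
    by_cases hx : x ∈ Ω
    · rw [indicator_of_mem hx, h1]
    · rw [indicator_of_notMem hx, h2 hx]
  have hv : v ∈ X₀ s Ω := mem_X₀_congr huv hu.mem
  have : IsFiniteMeasure (volume.restrict Ω) := ⟨by simpa using hΩfin.lt_top⟩
  obtain ⟨h, hh⟩ := exists_ae_le_of_gagliardoForm_truncation_le hN hs hΩ hΩfin hvm hv hv0
    (K := K) (C := lam / K ^ γ) hK.le <| by
      intro k hk
      have hφ := max_sub_mem_X₀ hv (hK.le.trans hk)
      rw [← gagliardoForm_congr huv (ae_eq_refl _), sub_eq_zero.1 (hu.weak_eq _ hφ),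
        ← integral_const_mul]
      have key : ∀ᵐ x ∂(volume.restrict Ω),
          0 ≤ (lam * Real.sign (u x) / |u x| ^ γ + g x (u x)) * max (v x - k) 0 ∧
          (lam * Real.sign (u x) / |u x| ^ γ + g x (u x)) * max (v x - k) 0 ≤
            lam / K ^ γ * max (v x - k) 0 := by
        filter_upwards [ae_restrict_of_ae huv, ae_restrict_mem hΩ] with x hx hxΩ
        rw [hx]
        rcases le_total (v x) k with hle | hle
        · simp [hle]
        · have hKv : K ≤ v x := hk.trans hle
          have hv0 : 0 < v x := hK.trans_le hKv
          rw [hg x hxΩ _ hKv, Real.sign_of_pos hv0, abs_of_pos hv0, mul_one, add_zero]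
          refine ⟨by positivity, ?_⟩
          gcongr
      exact integral_mono_of_nonneg (key.mono fun x hx => hx.1)
        ((hφ.1.2.1.integrable (by norm_num)).const_mul _) (key.mono fun x hx => hx.2)
  refine memLp_top_of_bound hu.mem.1.2.1.aestronglyMeasurable h ?_
  filter_upwards [hh, hpos, ae_restrict_of_ae huv] with x h1 h2 h3
  rw [Real.norm_of_nonneg h2, h3]
  exact h1

end FracSingular

end

theorem mainTheorem2
    (N : ℕ) (s γ lam : ℝ) (Ω : Set (EuclideanSpace ℝ (Fin N)))
    (hs : s ∈ Set.Ioo (0 : ℝ) 1) (hN : 2 * s < N)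
    (hγ : γ ∈ Set.Ioo (0 : ℝ) 1) (hlam : 0 < lam)
    (hΩ : IsOpen Ω) (hΩb : Bornology.IsBounded Ω)
    (f : EuclideanSpace ℝ (Fin N) → ℝ → ℝ)
    -- (A1)
    (hf : ContinuousOn (Function.uncurry f) (Ω ×ˢ Set.univ))
    (δ : ℝ) (hδ : 0 < δ) (hodd : ∀ x ∈ Ω, ∀ t : ℝ, |t| ≤ δ → f x (-t) = -f x t)
    -- (A2)
    (hzero : ∀ M : ℝ, ∃ η > 0, ∀ x ∈ Ω, ∀ t : ℝ, 0 < |t| → |t| < η → M ≤ f x t / t)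
    -- (A3)
    (r α : ℝ) (hr : 0 < r) (hα : α ∈ Set.Ioo (1 - γ) 2)
    (hAR : ∀ x ∈ Ω, ∀ t : ℝ, |t| ≤ r → t * f x t ≤ α * ∫ τ in (0 : ℝ)..t, f x τ)
    (l : ℝ) (hl : 0 < l) (hl' : l ≤ 1 / 2 * min δ r)
    (ξ : ℝ → ℝ) (hξ : FracSingular.IsCutoff l ξ)
    (u : EuclideanSpace ℝ (Fin N) → ℝ)
    (hu : FracSingular.IsWeakSolution s γ lam Ω (FracSingular.cutoffNonlinearity f ξ) u)
    (hpos : ∀ᵐ x ∂(MeasureTheory.volume.restrict Ω), 0 < u x) :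
    MeasureTheory.MemLp u ⊤ (MeasureTheory.volume.restrict Ω) := by
  refine FracSingular.memLp_top_of_isWeakSolution (K := 2 * l)
    (by exact_mod_cast (by linarith [hs.1] : (0 : ℝ) < N)) hs.1 hγ.1.le hlam.le
    hΩ.measurableSet hΩb.measure_lt_top.ne (by positivity) ?_ hu (hpos.mono fun x hx => hx.le)
  intro x _ t ht
  have ht0 : 0 ≤ t := by linarith
  rw [FracSingular.cutoffNonlinearity, if_pos ht0,
    hξ.eq_zero t (by rwa [abs_of_nonneg ht0]), mul_zero]
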